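/- Let $\mathbf{k}$ be a field and let $V$ be a $\mathbf{k}$-vector space with basis $X$. A dendriform dialgebra is a vector space $D$ with bilinear operations $\prec,\succ$ such that $(x\prec y)\prec z=x\prec(y\prec z+y\succ z)$, $(x\succ y)\prec z=x\succ(y\prec z)$ and $(x\prec y+x\succ y)\succ z=x\succ(y\succ z)$. A nonunitary Rota-Baxter algebra of weight zero is a nonunitary associative algebra $A$ with a linear operator $R$ such that $R(x)R(y)=R(R(x)y+xR(y))$. Let $\mathrm{Dend}(V)$ be the vector space with basis the planar binary trees $T\neq |$ whose vertices are decorated by elements of $X$, where $|$ is the tree with one leaf. Write $T=T^\ell\vee_x T^r$ for the grafting of $T^\ell$ and $T^r$ over $x\in X$. For $T=T^\ell\vee_x T^r$ and $U=U^\ell\vee_y U^r$ put recursively $$T\prec U=T^\ell\vee_x(T^r\star U),\qquad T\succ U=(T\star U^\ell)\vee_y U^r,$$ where $\star=\prec+\succ$ and $|\star T=T\star|=T$. Let $i_V:V\to\mathrm{Dend}(V)$ be the linear map with $x\mapsto |\vee_x|$ for $x\in X$. Let $\mathfrak{X}_\infty$ be the set of Rota-Baxter words on $X$: the nonempty words over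 $X\cup\{\lfloor,\rfloor\}$ whose factors are alternately elements of $X$ and bracketed words $\lfloor w\rfloor$ with $w\in\mathfrak{X}_\infty$. Let $\mathrm{RB}(V)$ be the vector space with basis $\mathfrak{X}_\infty$, with the linear operator $R(w)=\lfloor w\rfloor$ and the bilinear product $\diamond$ given as follows for words $w=w_1\cdots w_b$, $w'=w'_1\cdots w'_{b'}$ with their factors: $w\diamond w'=w_1\cdots w_{b-1}(w_b\diamond w'_1)w'_2\cdots w'_{b'}$, where $w_b\diamond w'_1$ is the concatenation if exactly one of $w_b,w'_1$ is in $X$, is $0$ if both are in $X$, and $\lfloor c\rfloor\diamond\lfloor c'\rfloor=\lfloor\lfloor c\rfloor\diamond c'\rfloor+\lfloor c\diamond\lfloor c'\rfloor\rfloor$ otherwise. Let $j_V:V\to\mathrm{RB}(V)$ be the linear map with $x\mapsto x$ for $x\in X$, and put $a\prec_R b=a\diamond R(b)$ and $a\succ_R b=R(a)\diamond b$. Let $\phi:\mathrm{Dend}(V)\to\mathrm{RB}(V)$ be the linear map given on trees recursively by $\phi(T^\ell\vee_x T^r)=\lfloor\phi(T^\ell)\rfloor\,x\,\lfloor\phi(T^r)\rfloor$,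 where the factor $\lfloor\phi(T^\ell)\rfloor$ (resp. $\lfloor\phi(T^r)\rfloor$) is left out if $T^\ell=|$ (resp. $T^r=|$). A dendriform diword is a word $u\in\mathfrak{X}_\infty$ that is not of the form $\lfloor w\rfloor$ with $w\in\mathfrak X_\infty$ and has no subword of the form $\lfloor\lfloor w\rfloor\rfloor$ or $x\lfloor w\rfloor y$ with $x,y\in X$ and $w\in\mathfrak{X}_\infty$. Then: 1. $(\mathrm{Dend}(V),\prec,\succ)$ with $i_V$ is the free dendriform dialgebra over the vector space $V$. 2. $(\mathrm{RB}(V),\diamond,R)$ with $j_V$ is the free nonunitary Rota-Baxter algebra of weight zero over the algebra $V$ with the zero product. 3. $(\mathrm{RB}(V),\prec_R,\succ_R)$ is a dendriform dialgebra, and $\phi$ is a homomorphism of dendriform dialgebras. 4. $\phi$ is the unique homomorphism of dendriform dialgebras with $\phi\circ i_V=j_V$. 5. The image of $\phi$ is the linear span of the dendriform diwords. 6. $\phi$ is injective. In particular, the free dendriform dialgebra over $V$ is a sub dendriform dialgebra of the free Rota-Baxter algebra of weight zero over $V$. -/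

import Mathlib

/-! ### Rota-Baxter algebras and dendriform dialgebras -/

/-- `A`, with the bilinear product `mul` and the linear operator `R`, is a nonunitary (associative)
Rota-Baxter algebra of weight `lam`. -/
structure IsRotaBaxterAlgebra {k A : Type*} [CommRing k] [AddCommGroup A] [Module k A]
    (lam : k) (mul : A →ₗ[k] A →ₗ[k] A) (R : A →ₗ[k] A) : Prop where
  assoc : ∀ x y z, mul (mul x y) z = mul x (mul y z)
  rota_baxter : ∀ x y, mul (R x) (R y) = R (mul (R x) y + mul x (R y) + lam • mul x y)

/-- Homomorphisms of nonunitary algebras. -/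
def IsAlgebraHom {k A B : Type*} [CommRing k] [AddCommGroup A] [Module k A]
    [AddCommGroup B] [Module k B] (mulA : A →ₗ[k] A →ₗ[k] A) (mulB : B →ₗ[k] B →ₗ[k] B)
    (f : A →ₗ[k] B) : Prop :=
  ∀ x y, f (mulA x y) = mulB (f x) (f y)

/-- `(F, mul, R, j)` is a free nonunitary Rota-Baxter algebra of weight `lam` over the nonunitary
algebra `(B, mulB)`; the test objects range over the universe `w`. -/
structure IsFreeRotaBaxterAlgebra.{w, u, v, t} {k : Type u} {B : Type v} {F : Type t} [CommRing k]
    [AddCommGroup B] [Module k B] [AddCommGroup F] [Module k F]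
    (lam : k) (mulB : B →ₗ[k] B →ₗ[k] B)
    (mul : F →ₗ[k] F →ₗ[k] F) (R : F →ₗ[k] F) (j : B →ₗ[k] F) : Prop where
  isRotaBaxterAlgebra : IsRotaBaxterAlgebra lam mul R
  isAlgebraHom : IsAlgebraHom mulB mul j
  existsUnique_lift : ∀ (A : Type w) [AddCommGroup A] [Module k A]
    (mulA : A →ₗ[k] A →ₗ[k] A) (RA : A →ₗ[k] A), IsRotaBaxterAlgebra lam mulA RA →
    ∀ f : B →ₗ[k] A, IsAlgebraHom mulB mulA f →
      ∃! g : F →ₗ[k] A, (IsAlgebraHom mul mulA g ∧ ∀ x, g (R x) = RA (g x)) ∧ g ∘ₗ j = f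

/-- `D`, with the bilinear operations `prec` (`≺`) and `succ` (`≻`), is a dendriform dialgebra. -/
structure IsDendriform {k D : Type*} [CommRing k] [AddCommGroup D] [Module k D]
    (prec succ : D →ₗ[k] D →ₗ[k] D) : Prop where
  prec_prec : ∀ x y z, prec (prec x y) z = prec x (prec y z + succ y z)
  succ_prec : ∀ x y z, prec (succ x y) z = succ x (prec y z)
  succ_succ : ∀ x y z, succ (prec x y + succ x y) z = succ x (succ y z)

/-- Homomorphisms of dendriform dialgebras. -/
structure IsDendriformHom {k D E : Type*} [CommRing k] [AddCommGroup D] [Module k D]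
    [AddCommGroup E] [Module k E] (precD succD : D →ₗ[k] D →ₗ[k] D)
    (precE succE : E →ₗ[k] E →ₗ[k] E) (f : D →ₗ[k] E) : Prop where
  map_prec : ∀ x y, f (precD x y) = precE (f x) (f y)
  map_succ : ∀ x y, f (succD x y) = succE (f x) (f y)

/-- `(F, prec, succ, i)` is a free dendriform dialgebra over the vector space `V`; the test
objects range over the universe `w`. -/
structure IsFreeDendriform.{w, u, v, t} {k : Type u} {V : Type v} {F : Type t} [CommRing k]
    [AddCommGroup V] [Module k V] [AddCommGroup F] [Module k F]
    (prec succ : F →ₗ[k] F →ₗ[k] F) (i : V →ₗ[k] F) : Prop where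
  isDendriform : IsDendriform prec succ
  existsUnique_lift : ∀ (D : Type w) [AddCommGroup D] [Module k D]
    (precD succD : D →ₗ[k] D →ₗ[k] D), IsDendriform precD succD →
    ∀ f : V →ₗ[k] D,
      ∃! g : F →ₗ[k] D, IsDendriformHom prec succ precD succD g ∧ g ∘ₗ i = f

/-- The operation `x ≺_R y = x R(y)`. -/
def rbPrec {k A : Type*} [CommRing k] [AddCommGroup A] [Module k A]
    (mul : A →ₗ[k] A →ₗ[k] A) (R : A →ₗ[k] A) : A →ₗ[k] A →ₗ[k] A :=
  mul.compl₂ R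

/-- The operation `x ≻_R y = R(x) y`. -/
def rbSucc {k A : Type*} [CommRing k] [AddCommGroup A] [Module k A]
    (mul : A →ₗ[k] A →ₗ[k] A) (R : A →ₗ[k] A) : A →ₗ[k] A →ₗ[k] A :=
  mul ∘ₗ R

/-- The bilinear extension of an operation given on basis elements. -/
noncomputable def bilinearExtension (k : Type*) [CommRing k] {S : Type*}
    (op : S → S → (S →₀ k)) : (S →₀ k) →ₗ[k] (S →₀ k) →ₗ[k] (S →₀ k) :=
  Finsupp.linearCombination k fun s => Finsupp.linearCombination k fun t => op s t

/-! ### Loday's dendriform dialgebra of decorated planar binary trees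

`BinaryTree X` is the type of planar binary trees with vertices decorated by `X`; `BinaryTree.nil`
is the tree `|` with one leaf, and `BinaryTree.node x l r` is the grafting `l ∨_x r`. -/

/-- Decorated planar binary trees other than `|`. -/
abbrev NTree (X : Type*) : Type _ := {T : BinaryTree X // T ≠ BinaryTree.nil}

/-- The grafting `l ∨_x r`. -/
def NTree.graft {X : Type*} (x : X) (l r : BinaryTree X) : NTree X :=
  ⟨BinaryTree.node x l r, by simp⟩

/-- The operation `⋆` on trees, with `| ⋆ T = T ⋆ | = T` and
`T ⋆ U = T^ℓ ∨_x (T^r ⋆ U) + (T ⋆ U^ℓ) ∨_y U^r`, the sum of `T ≺ U` and `T ≻ U`,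
for `T = T^ℓ ∨_x T^r` and `U = U^ℓ ∨_y U^r`. -/
noncomputable def treeStar (k : Type*) [CommRing k] {X : Type*} :
    BinaryTree X → BinaryTree X → (BinaryTree X →₀ k)
  | .nil, U => Finsupp.single U 1
  | .node x l r, .nil => Finsupp.single (.node x l r) 1
  | .node x l r, .node y l' r' =>
      (treeStar k r (.node y l' r')).mapDomain (fun S => .node x l S) +
      (treeStar k (.node x l r) l').mapDomain (fun S => .node y S r')
termination_by T U => sizeOf T + sizeOf U

/-- `T ≺ U = T^ℓ ∨_x (T^r ⋆ U)` for `T = T^ℓ ∨_x T^r`. -/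
noncomputable def treePrec (k : Type*) [CommRing k] {X : Type*} :
    NTree X → NTree X → (NTree X →₀ k)
  | ⟨.nil, h⟩, _ => absurd rfl h
  | ⟨.node x l r, _⟩, U => (treeStar k r U.1).mapDomain (fun S => NTree.graft x l S)

/-- `T ≻ U = (T ⋆ U^ℓ) ∨_y U^r` for `U = U^ℓ ∨_y U^r`. -/
noncomputable def treeSucc (k : Type*) [CommRing k] {X : Type*} :
    NTree X → NTree X → (NTree X →₀ k)
  | _, ⟨.nil, h⟩ => absurd rfl h
  | T, ⟨.node y l r, _⟩ => (treeStar k T.1 l).mapDomain (fun S => NTree.graft y S r)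

/-- On trees other than `|`, the operation `⋆` is `≺ + ≻`. -/
theorem treeStar_eq (k : Type*) [CommRing k] {X : Type*} (T U : NTree X) :
    treeStar k T.1 U.1 = (treePrec k T U + treeSucc k T U).mapDomain Subtype.val := by
  obtain ⟨T, hT⟩ := T
  obtain ⟨U, hU⟩ := U
  cases T with
  | nil => exact absurd rfl hT
  | node x l r =>
    cases U with
    | nil => exact absurd rfl hU
    | node y l' r' =>
      rw [Finsupp.mapDomain_add, treePrec, treeSucc, ← Finsupp.mapDomain_comp,
        ← Finsupp.mapDomain_comp, treeStar]
      rfl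

/-- The underlying vector space of `Dend(V)`, where `X` indexes a basis of `V`. -/
abbrev Dend (k X : Type*) [CommRing k] : Type _ := NTree X →₀ k

namespace Dend

/-- The operation `≺` of `Dend(V)`. -/
noncomputable def prec (k X : Type*) [CommRing k] :
    Dend k X →ₗ[k] Dend k X →ₗ[k] Dend k X :=
  bilinearExtension k (treePrec k)

/-- The operation `≻` of `Dend(V)`. -/
noncomputable def succ (k X : Type*) [CommRing k] :
    Dend k X →ₗ[k] Dend k X →ₗ[k] Dend k X :=
  bilinearExtension k (treeSucc k)

/-- The natural map `V → Dend(V)`, sending the basis vector `x` to `| ∨_x |`. -/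
noncomputable def incl {k V X : Type*} [CommRing k] [AddCommGroup V] [Module k V]
    (b : Module.Basis X k V) : V →ₗ[k] Dend k X :=
  b.constr k fun x => Finsupp.single (NTree.graft x .nil .nil) 1

end Dend

/-! ### The free Rota-Baxter algebra of weight zero over `V` with the zero product -/

/-- Rota-Baxter bracketed words on the alphabet `X`: the nonempty words whose factors are
alternately a letter of `X` and a bracketed Rota-Baxter word `⌊w⌋`. The index is the head of the
word: `false` if the first factor is a letter, `true` if it is a bracketed word. -/
inductive RBWord (X : Type*) : Bool → Type _
  /-- the word `x` -/
  | letter (x : X) : RBWord X false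
  /-- the word `x u`, where `u` begins with a bracketed word -/
  | letterCons (x : X) (u : RBWord X true) : RBWord X false
  /-- the word `⌊w⌋` -/
  | bracket {h : Bool} (w : RBWord X h) : RBWord X true
  /-- the word `⌊w⌋ u`, where `u` begins with a letter -/
  | bracketCons {h : Bool} (w : RBWord X h) (u : RBWord X false) : RBWord X true

/-- The set `𝔛_∞` of all Rota-Baxter words. -/
abbrev RBWords (X : Type*) : Type _ := Σ h : Bool, RBWord X h

/-- The alphabet `X ∪ {⌊, ⌋}`. -/
inductive BracketLetter (X : Type*) : Type _
  | var (x : X)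
  | lb
  | rb

namespace RBWord

/-- A Rota-Baxter word spelled out in the alphabet `X ∪ {⌊, ⌋}`. -/
def spell {X : Type*} : {h : Bool} → RBWord X h → List (BracketLetter X)
  | _, letter x => [.var x]
  | _, letterCons x u => .var x :: spell u
  | _, bracket w => .lb :: (spell w ++ [.rb])
  | _, bracketCons w u => .lb :: (spell w ++ .rb :: spell u)

/-- The product `w ⋄ w'` of two Rota-Baxter words, in weight zero and with the zero product on the
span of `X`. If the last factor `a` of `w` and the first factor `a'` of `w'` are of different
kinds, it is the concatenation. Otherwise these two factors are replaced by `a ⋄ a'`, which is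
`0` if both are letters, and `⌊⌊c⌋ ⋄ c'⌋ + ⌊c ⋄ ⌊c'⌋⌋` if `a = ⌊c⌋` and `a' = ⌊c'⌋`.
The product has the same head as `w`. -/
noncomputable def mul (k : Type*) [CommRing k] {X : Type*} :
    {h h' : Bool} → RBWord X h → RBWord X h' → (RBWord X h →₀ k)
  | _, _, letterCons x u, w' => (mul k u w').mapDomain (fun c => letterCons x c)
  | _, _, bracketCons w u, w' => (mul k u w').mapDomain (fun c => bracketCons w c)
  | _, _, letter _, letter _ => 0
  | _, _, letter _, letterCons _ _ => 0
  | _, _, letter x, bracket c' => Finsupp.single (letterCons x (bracket c')) 1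
  | _, _, letter x, bracketCons c' v => Finsupp.single (letterCons x (bracketCons c' v)) 1
  | _, _, bracket c, letter x => Finsupp.single (bracketCons c (letter x)) 1
  | _, _, bracket c, letterCons x v => Finsupp.single (bracketCons c (letterCons x v)) 1
  | _, _, bracket c, bracket c' =>
      (mul k (bracket c) c').mapDomain (fun d => bracket d) +
      (mul k c (bracket c')).mapDomain (fun d => bracket d)
  | _, _, bracket c, bracketCons c' v =>
      (mul k (bracket c) c').mapDomain (fun d => bracketCons d v) +
      (mul k c (bracket c')).mapDomain (fun d => bracketCons d v)
termination_by _ _ w w' => sizeOf w + sizeOf w'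

end RBWord

/-- The underlying vector space of the free Rota-Baxter algebra over `V`, where `X` indexes a
basis of `V`. -/
abbrev FreeRB (k X : Type*) [CommRing k] : Type _ := RBWords X →₀ k

namespace FreeRB

/-- The product `⋄`. -/
noncomputable def mul (k X : Type*) [CommRing k] :
    FreeRB k X →ₗ[k] FreeRB k X →ₗ[k] FreeRB k X :=
  bilinearExtension k fun w w' => (RBWord.mul k w.2 w'.2).mapDomain (fun c => ⟨w.1, c⟩)

/-- The Rota-Baxter operator `w ↦ ⌊w⌋`. -/
noncomputable def op (k X : Type*) [CommRing k] : FreeRB k X →ₗ[k] FreeRB k X :=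
  Finsupp.lmapDomain k k fun w => ⟨true, .bracket w.2⟩

/-- The natural map `j_V : V → FreeRB`, sending the basis vector `x` to the word `x`. -/
noncomputable def incl {k V X : Type*} [CommRing k] [AddCommGroup V] [Module k V]
    (b : Module.Basis X k V) : V →ₗ[k] FreeRB k X :=
  b.constr k fun x => Finsupp.single ⟨false, .letter x⟩ 1

/-- The operation `w ≺_R w' = w ⋄ ⌊w'⌋`. -/
noncomputable def prec (k X : Type*) [CommRing k] :
    FreeRB k X →ₗ[k] FreeRB k X →ₗ[k] FreeRB k X :=
  rbPrec (mul k X) (op k X)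

/-- The operation `w ≻_R w' = ⌊w⌋ ⋄ w'`. -/
noncomputable def succ (k X : Type*) [CommRing k] :
    FreeRB k X →ₗ[k] FreeRB k X →ₗ[k] FreeRB k X :=
  rbSucc (mul k X) (op k X)

end FreeRB

/-! ### The map `φ` and dendriform diwords -/

/-- The Rota-Baxter word `φ(T)` of a tree `T ≠ |`: for `T = T^ℓ ∨_x T^r` it is
`⌊φ(T^ℓ)⌋ x ⌊φ(T^r)⌋`, where the bracket of a subtree equal to `|` is left out. -/
def treeWord {X : Type*} : (T : BinaryTree X) → T ≠ BinaryTree.nil → RBWords X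
  | .nil, h => absurd rfl h
  | .node x .nil .nil, _ => ⟨false, .letter x⟩
  | .node x .nil (.node z r₁ r₂), _ =>
      ⟨false, .letterCons x (.bracket (treeWord (.node z r₁ r₂) (by simp)).2)⟩
  | .node x (.node y l₁ l₂) .nil, _ =>
      ⟨true, .bracketCons (treeWord (.node y l₁ l₂) (by simp)).2 (.letter x)⟩
  | .node x (.node y l₁ l₂) (.node z r₁ r₂), _ =>
      ⟨true, .bracketCons (treeWord (.node y l₁ l₂) (by simp)).2
        (.letterCons x (.bracket (treeWord (.node z r₁ r₂) (by simp)).2))⟩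

/-- The linear map `φ : Dend(V) → FreeRB`. -/
noncomputable def dendToRB (k X : Type*) [CommRing k] : Dend k X →ₗ[k] FreeRB k X :=
  Finsupp.lmapDomain k k fun T => treeWord T.1 T.2

/-- Dendriform diwords: the Rota-Baxter words that are not of the form `⌊w⌋` and contain, as words
in the alphabet `X ∪ {⌊, ⌋}`, no subword `⌊⌊w⌋⌋` and no subword `x ⌊w⌋ y` with `x, y ∈ X` and a
Rota-Baxter word `w`. -/
structure IsDiword {X : Type*} (u : RBWords X) : Prop where
  not_bracket : ∀ w : RBWords X, u ≠ ⟨true, .bracket w.2⟩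
  not_bracket_bracket : ∀ w : RBWords X,
    ¬ ([.lb, .lb] ++ w.2.spell ++ [.rb, .rb]) <:+: u.2.spell
  not_letter_bracket_letter : ∀ (x y : X) (w : RBWords X),
    ¬ ([.var x, .lb] ++ w.2.spell ++ [.rb, .var y]) <:+: u.2.spell

/-- The span `DW(V)` of the dendriform diwords. -/
noncomputable def diwordSpan (k X : Type*) [CommRing k] : Submodule k (FreeRB k X) :=
  Submodule.span k ((fun u => Finsupp.single u 1) '' {u : RBWords X | IsDiword u})

universe w₁ w₂ u v t

/-! Everything rests on the decomposition `T = (T^ℓ ≻ x) ≺ T^r`, with empty subtrees omitted. It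
forces the value of a dendriform homomorphism on each tree (`Dend.hom_eq_lift`). Conversely, let a
tree act on a dendriform dialgebra by `T ≻ -` and `- ≺ T`, with `|` acting as the identity. The
axioms then say that left and right actions commute and that `T ⋆ U` acts as a composite
(`treeAct_treeStar`), and this makes evaluation a homomorphism. Only the axioms of the target enter
here, not those of `Dend(V)`.

On the Rota-Baxter side, associativity of `⋄` is an induction on three words, whose essential case
is three bracketed words (`RBWord.mulL_mul_assoc`). Freeness holds because each recursive clause of
`⋄` is an identity valid in every test algebra (`RBWord.evalL_mul`), and because words are built
from letters by `⋄` and `R`.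

In weight zero `R(a)R(b) = R(a ≺_R b + a ≻_R b)`, so `RB(V)` is dendriform. The word `⌊φ(T^ℓ)⌋ x
⌊φ(T^r)⌋` is a product needing no reduction, so `φ` is evaluation in `RB(V)` and hence a
homomorphism. It carries distinct trees to distinct words, so it is injective, and the axioms of
`Dend(V)` are inherited from `RB(V)`.

For the image, forbidden subwords may start anywhere in the spelled word, across its factors. A
stack automaton handles this: it rejects each forbidden pattern from every stack but accepts the
words of trees. Conversely, a diword has exactly one letter at top level, with at most one bracket
on each side, and the bracket contents are again diwords. -/

/-! ### Bilinear extensions -/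

theorem bilinearExtension_single (k : Type*) [CommRing k] {S : Type*} (op : S → S → (S →₀ k))
    (s t : S) :
    bilinearExtension k op (Finsupp.single s 1) (Finsupp.single t 1) = op s t := by
  simp [bilinearExtension]

/-- A linear map intertwines a bilinearly extended operation with a bilinear operation as soon as it
does so on basis elements. -/
theorem map_bilinearExtension {k S A : Type*} [CommRing k] [AddCommGroup A] [Module k A]
    (op : S → S → (S →₀ k)) (mul : A →ₗ[k] A →ₗ[k] A) (g : (S →₀ k) →ₗ[k] A)
    (h : ∀ s t, g (op s t) = mul (g (Finsupp.single s 1)) (g (Finsupp.single t 1)))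
    (x y : S →₀ k) : g (bilinearExtension k op x y) = mul (g x) (g y) := by
  have : (bilinearExtension k op).compr₂ g = mul.compl₁₂ g g := by
    ext s t
    simpa [bilinearExtension] using h s t
  exact congrArg (fun m => m x y) this

/-! ### Rota-Baxter algebras of weight zero are dendriform -/

/-- The middle axiom is bare associativity. The other two also use that in weight zero `R` turns `≺
+ ≻` into the product. -/
theorem IsRotaBaxterAlgebra.isDendriform {k A : Type*} [CommRing k] [AddCommGroup A] [Module k A]
    {mul : A →ₗ[k] A →ₗ[k] A} {R : A →ₗ[k] A} (h : IsRotaBaxterAlgebra (0 : k) mul R) :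
    IsDendriform (rbPrec mul R) (rbSucc mul R) where
  prec_prec x y z := by
    simp only [rbPrec, rbSucc, LinearMap.compl₂_apply, LinearMap.comp_apply]
    rw [h.assoc, h.rota_baxter, zero_smul, add_zero, add_comm]
  succ_prec x y z := by
    simp only [rbPrec, rbSucc, LinearMap.compl₂_apply, LinearMap.comp_apply]
    rw [h.assoc]
  succ_succ x y z := by
    simp only [rbPrec, rbSucc, LinearMap.compl₂_apply, LinearMap.comp_apply]
    rw [← h.assoc, h.rota_baxter, zero_smul, add_zero, add_comm]

/-! ### Evaluation of trees in a dendriform dialgebra -/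

section Eval

variable {k D X : Type*} [CommRing k] [AddCommGroup D] [Module k D]

/-- The value of a tree in a dendriform dialgebra, given by
`T^ℓ ∨_x T^r ↦ (T^ℓ ≻ f x) ≺ T^r`, where subtrees equal to `|` are left out. The value at `|` is
irrelevant. -/
def treeEval (prec succ : D →ₗ[k] D →ₗ[k] D) (f : X → D) : BinaryTree X → D
  | .nil => 0
  | .node x .nil .nil => f x
  | .node x .nil (.node z r₁ r₂) => prec (f x) (treeEval prec succ f (.node z r₁ r₂))
  | .node x (.node y l₁ l₂) .nil => succ (treeEval prec succ f (.node y l₁ l₂)) (f x)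
  | .node x (.node y l₁ l₂) (.node z r₁ r₂) =>
      prec (succ (treeEval prec succ f (.node y l₁ l₂)) (f x))
        (treeEval prec succ f (.node z r₁ r₂))

/-- The operator `y ↦ T ≻ y`, which is the identity for `T = |`. -/
def treeActL (prec succ : D →ₗ[k] D →ₗ[k] D) (f : X → D) : BinaryTree X → (D →ₗ[k] D)
  | .nil => LinearMap.id
  | .node x l r => succ (treeEval prec succ f (.node x l r))

/-- The operator `y ↦ y ≺ T`, which is the identity for `T = |`. -/
def treeActR (prec succ : D →ₗ[k] D →ₗ[k] D) (f : X → D) : BinaryTree X → (D →ₗ[k] D)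
  | .nil => LinearMap.id
  | .node x l r => prec.flip (treeEval prec succ f (.node x l r))

variable (prec succ : D →ₗ[k] D →ₗ[k] D) (f : X → D)

/-- Letting `|` act as the identity merges the four cases of `treeEval` into one formula, linear in
the operator of either subtree. It can thus be extended to sums of trees such as `T^r ⋆ U`. -/
theorem treeEval_node (x : X) (l r : BinaryTree X) :
    treeEval prec succ f (.node x l r) =
      treeActR prec succ f r (treeActL prec succ f l (f x)) := by
  cases l <;> cases r <;> simp [treeEval, treeActL, treeActR]

/-- Linear extension of `treeEval`. -/
noncomputable def treeEvalL : (BinaryTree X →₀ k) →ₗ[k] D :=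
  Finsupp.linearCombination k (treeEval prec succ f)

/-- Linear extension of `treeActL`. -/
noncomputable def treeActLL : (BinaryTree X →₀ k) →ₗ[k] (D →ₗ[k] D) :=
  Finsupp.linearCombination k (treeActL prec succ f)

/-- Linear extension of `treeActR`. -/
noncomputable def treeActRL : (BinaryTree X →₀ k) →ₗ[k] (D →ₗ[k] D) :=
  Finsupp.linearCombination k (treeActR prec succ f)

theorem treeEvalL_mapDomain_right (x : X) (l : BinaryTree X) (s : BinaryTree X →₀ k) :
    treeEvalL prec succ f (s.mapDomain fun S => .node x l S) =
      treeActRL prec succ f s (treeActL prec succ f l (f x)) := by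
  induction s using Finsupp.induction_linear with
  | zero => simp
  | add a b ha hb => simp [Finsupp.mapDomain_add, ha, hb]
  | single a c => simp [Finsupp.mapDomain_single, treeEvalL, treeActRL, treeEval_node]

theorem treeEvalL_mapDomain_left (x : X) (r : BinaryTree X) (s : BinaryTree X →₀ k) :
    treeEvalL prec succ f (s.mapDomain fun S => .node x S r) =
      treeActR prec succ f r (treeActLL prec succ f s (f x)) := by
  induction s using Finsupp.induction_linear with
  | zero => simp
  | add a b ha hb => simp [Finsupp.mapDomain_add, ha, hb]
  | single a c => simp [Finsupp.mapDomain_single, treeEvalL, treeActLL, treeEval_node]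

/-- The operator of `|` is the identity while its value is the dummy `0`, so passing from value to
operator is valid only away from `|`; `hn` guarantees this. -/
theorem treeActRL_mapDomain {Y : Type*} (n : Y → BinaryTree X) (hn : ∀ S, n S ≠ .nil)
    (s : Y →₀ k) : treeActRL prec succ f (s.mapDomain n) =
      prec.flip (treeEvalL prec succ f (s.mapDomain n)) := by
  induction s using Finsupp.induction_linear with
  | zero => simp
  | add a b ha hb => simp [Finsupp.mapDomain_add, ha, hb]
  | single a c =>
    have : treeActR prec succ f (n a) = prec.flip (treeEval prec succ f (n a)) := by
      cases h : n a with
      | nil => exact absurd h (hn a)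
      | node => rfl
    simp [Finsupp.mapDomain_single, treeEvalL, treeActRL, this]

theorem treeActLL_mapDomain {Y : Type*} (n : Y → BinaryTree X) (hn : ∀ S, n S ≠ .nil)
    (s : Y →₀ k) : treeActLL prec succ f (s.mapDomain n) =
      succ (treeEvalL prec succ f (s.mapDomain n)) := by
  induction s using Finsupp.induction_linear with
  | zero => simp
  | add a b ha hb => simp [Finsupp.mapDomain_add, ha, hb]
  | single a c =>
    have : treeActL prec succ f (n a) = succ (treeEval prec succ f (n a)) := by
      cases h : n a with
      | nil => exact absurd h (hn a)
      | node => rfl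
    simp [Finsupp.mapDomain_single, treeEvalL, treeActLL, this]

variable {prec succ}

/-- This is the middle dendriform axiom, trivially extended to `|`. -/
theorem treeActR_treeActL_comm (hD : IsDendriform prec succ) (T U : BinaryTree X) (d : D) :
    treeActR prec succ f U (treeActL prec succ f T d) =
      treeActL prec succ f T (treeActR prec succ f U d) := by
  cases T <;> cases U <;> simp [treeActL, treeActR, hD.succ_prec]

/-- The operators attached to `T ⋆ U` are the composites of those attached to `T` and `U`. -/
theorem treeAct_treeStar (hD : IsDendriform prec succ) (T U : BinaryTree X) :
    treeActLL prec succ f (treeStar k T U) = treeActL prec succ f T ∘ₗ treeActL prec succ f U ∧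
    treeActRL prec succ f (treeStar k T U) = treeActR prec succ f U ∘ₗ treeActR prec succ f T := by
  match T, U with
  | .nil, U =>
    rw [treeStar]
    simp [treeActLL, treeActRL, treeActL, treeActR, LinearMap.comp_id, LinearMap.id_comp]
  | .node x l r, .nil =>
    rw [treeStar]
    simp [treeActLL, treeActRL, treeActL, treeActR, LinearMap.comp_id, LinearMap.id_comp]
  | .node x l r, .node y l' r' =>
    have h₁ := (treeAct_treeStar hD r (.node y l' r')).2
    have h₂ := (treeAct_treeStar hD (.node x l r) l').1
    -- The induction hypotheses concern operators; applied to the letters `x` and `y` they yield the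
    -- value of `T ⋆ U`. The outer dendriform axioms then turn this value back into operators.
    have key : treeEvalL prec succ f (treeStar k (.node x l r) (.node y l' r')) =
        prec (treeEval prec succ f (.node x l r)) (treeEval prec succ f (.node y l' r')) +
        succ (treeEval prec succ f (.node x l r)) (treeEval prec succ f (.node y l' r')) := by
      rw [treeStar, map_add, treeEvalL_mapDomain_right, treeEvalL_mapDomain_left, h₁, h₂,
        LinearMap.comp_apply, LinearMap.comp_apply, treeActR_treeActL_comm f hD _ r',
        ← treeEval_node, ← treeEval_node]
      rfl
    have hL : treeActLL prec succ f (treeStar k (.node x l r) (.node y l' r')) =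
        succ (treeEvalL prec succ f (treeStar k (.node x l r) (.node y l' r'))) := by
      rw [treeStar, map_add, map_add, map_add, treeActLL_mapDomain _ _ _ _ (by simp),
        treeActLL_mapDomain _ _ _ _ (by simp)]
    have hR : treeActRL prec succ f (treeStar k (.node x l r) (.node y l' r')) =
        prec.flip (treeEvalL prec succ f (treeStar k (.node x l r) (.node y l' r'))) := by
      rw [treeStar, map_add, map_add, map_add, treeActRL_mapDomain _ _ _ _ (by simp),
        treeActRL_mapDomain _ _ _ _ (by simp)]
    rw [hL, hR, key]
    constructor
    · ext d
      exact hD.succ_succ _ _ _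
    · ext d
      exact (hD.prec_prec _ _ _).symm
termination_by sizeOf T + sizeOf U

end Eval

/-! ### The lift to a dendriform dialgebra -/

section Lift

variable {k D X : Type*} [CommRing k] [AddCommGroup D] [Module k D]
  (prec succ : D →ₗ[k] D →ₗ[k] D) (f : X → D)

/-- The linear map from the free dendriform dialgebra that evaluates trees. -/
noncomputable def Dend.lift : Dend k X →ₗ[k] D :=
  Finsupp.linearCombination k fun T => treeEval prec succ f T.1

theorem Dend.lift_single (T : NTree X) :
    Dend.lift prec succ f (Finsupp.single T 1) = treeEval prec succ f T.1 := by
  simp [Dend.lift]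

theorem Dend.lift_mapDomain {Y : Type*} (n : Y → NTree X) (s : Y →₀ k) :
    Dend.lift prec succ f (s.mapDomain n) =
      treeEvalL prec succ f (s.mapDomain fun S => (n S).1) := by
  simp [Dend.lift, treeEvalL, Finsupp.linearCombination_mapDomain, Function.comp_def]

variable {prec succ} in
theorem Dend.lift_isDendriformHom (hD : IsDendriform prec succ) :
    IsDendriformHom (Dend.prec k X) (Dend.succ k X) prec succ (Dend.lift prec succ f) where
  map_prec := by
    refine map_bilinearExtension _ _ _ ?_
    rintro ⟨T, hT⟩ ⟨U, hU⟩
    cases T with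
    | nil => exact absurd rfl hT
    | node x l r =>
      cases U with
      | nil => exact absurd rfl hU
      | node y l' r' =>
        rw [treePrec, Dend.lift_mapDomain, Dend.lift_single, Dend.lift_single]
        refine (treeEvalL_mapDomain_right prec succ f x l _).trans ?_
        rw [(treeAct_treeStar f hD _ _).2, LinearMap.comp_apply, ← treeEval_node]
        rfl
  map_succ := by
    refine map_bilinearExtension _ _ _ ?_
    rintro ⟨T, hT⟩ ⟨U, hU⟩
    cases T with
    | nil => exact absurd rfl hT
    | node x l r =>
      cases U with
      | nil => exact absurd rfl hU
      | node y l' r' =>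
        rw [treeSucc, Dend.lift_mapDomain, Dend.lift_single, Dend.lift_single]
        refine (treeEvalL_mapDomain_left prec succ f y r' _).trans ?_
        rw [(treeAct_treeStar f hD _ _).1, LinearMap.comp_apply, treeActR_treeActL_comm f hD,
          ← treeEval_node]
        rfl

/-- Since `| ⋆ T = T`, the recursion stops at once. Together with `Dend.succ_single_left` this
generates every tree from the trees `| ∨_x |`. -/
theorem Dend.prec_single_right (x : X) (l : BinaryTree X) (r : NTree X) :
    Dend.prec k X (Finsupp.single (NTree.graft x l .nil) 1) (Finsupp.single r 1) =
      Finsupp.single (NTree.graft x l r.1) 1 := by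
  rw [Dend.prec, bilinearExtension_single, NTree.graft, treePrec, treeStar,
    Finsupp.mapDomain_single]

theorem Dend.succ_single_left (x : X) (l : NTree X) :
    Dend.succ k X (Finsupp.single l 1) (Finsupp.single (NTree.graft x .nil .nil) 1) =
      Finsupp.single (NTree.graft x l.1 .nil) 1 := by
  obtain ⟨l, hl⟩ := l
  cases l with
  | nil => exact absurd rfl hl
  | node =>
    rw [Dend.succ, bilinearExtension_single, NTree.graft, treeSucc, treeStar,
      Finsupp.mapDomain_single]

variable {prec succ f} in
theorem Dend.hom_eq_lift {g : Dend k X →ₗ[k] D}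
    (hg : IsDendriformHom (Dend.prec k X) (Dend.succ k X) prec succ g)
    (hf : ∀ x, g (Finsupp.single (NTree.graft x .nil .nil) 1) = f x) :
    g = Dend.lift prec succ f := by
  have main : ∀ (T : BinaryTree X) (hT : T ≠ .nil),
      g (Finsupp.single ⟨T, hT⟩ 1) = treeEval prec succ f T := by
    intro T
    induction T with
    | nil => intro h; exact absurd rfl h
    | node x l r ihl ihr =>
      intro hT
      have hl : g (Finsupp.single (NTree.graft x l .nil) 1) = treeActL prec succ f l (f x) := by
        cases l with
        | nil => exact hf x
        | node y l₁ l₂ =>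
          have := Dend.succ_single_left (k := k) x ⟨.node y l₁ l₂, by simp⟩
          rw [← this, hg.map_succ, ihl, hf]
          rfl
      rw [treeEval_node, ← hl]
      cases r with
      | nil => rfl
      | node z r₁ r₂ =>
        have := Dend.prec_single_right (k := k) x l ⟨.node z r₁ r₂, by simp⟩
        refine (congrArg g this.symm).trans ?_
        rw [hg.map_prec, ihr]
        rfl
  refine Finsupp.lhom_ext' fun T => LinearMap.ext_ring ?_
  simpa [Dend.lift_single] using main T.1 T.2

end Lift

theorem Dend.existsUnique_lift {k V X D : Type*} [CommRing k] [AddCommGroup V] [Module k V]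
    [AddCommGroup D] [Module k D] (b : Module.Basis X k V)
    {prec succ : D →ₗ[k] D →ₗ[k] D} (hD : IsDendriform prec succ) (f : V →ₗ[k] D) :
    ∃! g : Dend k X →ₗ[k] D,
      IsDendriformHom (Dend.prec k X) (Dend.succ k X) prec succ g ∧ g ∘ₗ Dend.incl b = f := by
  refine ⟨Dend.lift prec succ fun x => f (b x), ⟨Dend.lift_isDendriformHom _ hD, ?_⟩, ?_⟩
  · refine b.ext fun x => ?_
    simp [Dend.incl, Dend.lift_single, NTree.graft, treeEval]
  · rintro g ⟨hg, rfl⟩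
    refine Dend.hom_eq_lift hg fun x => ?_
    simp [Dend.incl]

/-! ### The product of Rota-Baxter words, bilinearly extended -/

namespace RBWord

section Mul

variable (k : Type*) [CommRing k] {X : Type*} {h h' h'' : Bool}

/-- The bilinear extension of the product of Rota-Baxter words with given heads. -/
noncomputable def mulL (h h' : Bool) :
    (RBWord X h →₀ k) →ₗ[k] (RBWord X h' →₀ k) →ₗ[k] (RBWord X h →₀ k) :=
  Finsupp.linearCombination k fun s => Finsupp.linearCombination k fun t => mul k s t

/-- The linear extension of `u ↦ x u`. -/
noncomputable def consL (x : X) : (RBWord X true →₀ k) →ₗ[k] (RBWord X false →₀ k) :=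
  Finsupp.lmapDomain k k fun c => letterCons x c

/-- The linear extension of `w ↦ ⌊w⌋`. -/
noncomputable def bracketL (h : Bool) : (RBWord X h →₀ k) →ₗ[k] (RBWord X true →₀ k) :=
  Finsupp.lmapDomain k k fun c => bracket c

/-- The bilinear extension of `(w, u) ↦ ⌊w⌋ u`. -/
noncomputable def bracketConsL (h : Bool) :
    (RBWord X h →₀ k) →ₗ[k] (RBWord X false →₀ k) →ₗ[k] (RBWord X true →₀ k) :=
  Finsupp.linearCombination k fun s => Finsupp.lmapDomain k k fun t => bracketCons s t

variable {k}

theorem mulL_single (w : RBWord X h) (w' : RBWord X h') :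
    mulL k h h' (Finsupp.single w 1) (Finsupp.single w' 1) = mul k w w' := by
  simp [mulL]

theorem consL_single (x : X) (u : RBWord X true) : consL k x (Finsupp.single u 1) = Finsupp.single (letterCons x u) 1 := by
  simp [consL]

theorem bracketL_single (w : RBWord X h) : bracketL k h (Finsupp.single w 1) = Finsupp.single (bracket w) 1 := by
  simp [bracketL]

theorem bracketConsL_single (w : RBWord X h) (u : RBWord X false) :
    bracketConsL k h (Finsupp.single w 1) (Finsupp.single u 1) = Finsupp.single (bracketCons w u) 1 := by
  simp [bracketConsL]

/-- Only the last factor of the left word takes part in the product, so an earlier one is carried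
along unchanged. -/
theorem mulL_consL (x : X) (p : RBWord X true →₀ k) (q : RBWord X h →₀ k) :
    mulL k false h (consL k x p) q = consL k x (mulL k true h p q) := by
  have : mulL k false h ∘ₗ consL k x = (mulL k true h).compr₂ (consL k x) := by
    ext u w : 4
    simp [consL, mulL, mul]
  exact congrArg (fun m => m p q) this

theorem mulL_bracketConsL (p : RBWord X h →₀ k) (q : RBWord X false →₀ k)
    (r : RBWord X h' →₀ k) :
    mulL k true h' (bracketConsL k h p q) r = bracketConsL k h p (mulL k false h' q r) := by
  induction p using Finsupp.induction_linear with
  | zero => simp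
  | add a b ha hb => simp [ha, hb]
  | single a c =>
    induction q using Finsupp.induction_linear with
    | zero => simp
    | add a b ha hb => simp [ha, hb]
    | single a' c' =>
      induction r using Finsupp.induction_linear with
      | zero => simp
      | add a b ha hb => simp only [map_add, ha, hb]
      | single a'' c'' =>
        have hs : ∀ {h : Bool} (w : RBWord X h) (c : k),
            Finsupp.single w c = c • Finsupp.single w 1 := by simp
        rw [hs a, hs a', hs a'']
        simp only [map_smul, LinearMap.smul_apply, bracketConsL_single, mulL_single]
        rw [mul]
        simp [bracketConsL]

theorem mulL_letter_true (x : X) (p : RBWord X true →₀ k) :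
    mulL k false true (Finsupp.single (letter x) 1) p = consL k x p := by
  induction p using Finsupp.induction_linear with
  | zero => simp
  | add a b ha hb => simp_all
  | single a c => cases a <;> simp [mulL, mul, consL]

theorem mulL_letter_false (x : X) (p : RBWord X false →₀ k) :
    mulL k false false (Finsupp.single (letter x) 1) p = 0 := by
  induction p using Finsupp.induction_linear with
  | zero => simp
  | add a b ha hb => simp_all
  | single a c => cases a <;> simp [mulL, mul]

theorem mulL_bracketL_false (p : RBWord X h →₀ k) (q : RBWord X false →₀ k) :
    mulL k true false (bracketL k h p) q = bracketConsL k h p q := by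
  induction p using Finsupp.induction_linear with
  | zero => simp
  | add a b ha hb => simp_all
  | single a c =>
    induction q using Finsupp.induction_linear with
    | zero => simp
    | add a b ha hb => simp_all
    | single a' c' => cases a' <;> simp [mulL, mul, bracketL, bracketConsL]

theorem mulL_bracketL_bracketL (p : RBWord X h →₀ k) (q : RBWord X h' →₀ k) :
    mulL k true true (bracketL k h p) (bracketL k h' q) =
      bracketL k true (mulL k true h' (bracketL k h p) q) +
      bracketL k h (mulL k h true p (bracketL k h' q)) := by
  induction p using Finsupp.induction_linear with
  | zero => simp
  | add a b ha hb => simp only [map_add, LinearMap.add_apply, ha, hb]; abel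
  | single a c =>
    induction q using Finsupp.induction_linear with
    | zero => simp
    | add a b ha hb => simp only [map_add, ha, hb]; abel
    | single a' c' => simp [mulL, mul, bracketL]

theorem mulL_bracketL_bracketConsL (p : RBWord X h →₀ k) (q : RBWord X h' →₀ k)
    (r : RBWord X false →₀ k) :
    mulL k true true (bracketL k h p) (bracketConsL k h' q r) =
      bracketConsL k true (mulL k true h' (bracketL k h p) q) r +
      bracketConsL k h (mulL k h true p (bracketL k h' q)) r := by
  -- In `RBWord.mul` the sum sits in the bracketed slot with the tail `v` fixed; this rewrites it
  -- through the bilinear `bracketConsL`.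
  have aux : ∀ (h₁ : Bool) (s : RBWord X h₁ →₀ k) (v : RBWord X false),
      s.mapDomain (fun d => bracketCons d v) = bracketConsL k h₁ s (Finsupp.single v 1) := by
    intro h₁ s v
    induction s using Finsupp.induction_linear with
    | zero => simp
    | add a b ha hb => simp_all [Finsupp.mapDomain_add]
    | single a c => simp [bracketConsL]
  induction p using Finsupp.induction_linear with
  | zero => simp
  | add a b ha hb => simp only [map_add, LinearMap.add_apply, ha, hb]; abel
  | single a c =>
    induction q using Finsupp.induction_linear with
    | zero => simp
    | add a b ha hb => simp only [map_add, LinearMap.add_apply, ha, hb]; abel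
    | single a' c' =>
      induction r using Finsupp.induction_linear with
      | zero => simp
      | add a b ha hb => simp only [map_add, ha, hb]; abel
      | single v e =>
        have hs : ∀ {h : Bool} (w : RBWord X h) (c : k), Finsupp.single w c = c • Finsupp.single w 1 := by simp
        rw [hs a, hs a', hs v]
        simp only [map_smul, LinearMap.smul_apply, bracketL_single, bracketConsL_single,
          mulL_single, ← smul_add]
        rw [mul, aux, aux]

/-- The product of Rota-Baxter words is associative. -/
theorem mulL_mul_assoc {h h' h'' : Bool} (w : RBWord X h) (w' : RBWord X h') (w'' : RBWord X h'') :
    mulL k h h'' (mul k w w') (Finsupp.single w'' 1) = mulL k h h' (Finsupp.single w 1) (mul k w' w'') := by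
  match h, w, h', w' with
  | _, letterCons x u, _, w' =>
    rw [← mulL_single, ← consL_single, mulL_consL, mulL_consL, mulL_consL, mulL_single,
      mulL_mul_assoc u w' w'']
  | _, bracketCons c u, _, w' =>
    rw [← mulL_single, ← bracketConsL_single, mulL_bracketConsL, mulL_bracketConsL,
      mulL_bracketConsL, mulL_single, mulL_mul_assoc u w' w'']
  -- Both `w'` and every term of `w' ⋄ w''` begin with a letter, since a product keeps the head of
  -- its left factor; both sides vanish.
  | _, letter x, false, w' =>
    rw [← mulL_single, mulL_letter_false, mulL_letter_false, map_zero, LinearMap.zero_apply]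
  | _, letter x, true, w' =>
    rw [← mulL_single, mulL_letter_true, mulL_letter_true, mulL_consL, mulL_single]
  | _, bracket c, false, w' =>
    rw [← mulL_single, ← bracketL_single, mulL_bracketL_false, mulL_bracketL_false,
      mulL_bracketConsL, mulL_single]
  -- Here `⌊c⌋` meets only `⌊c'⌋`, and `w''` meets only `v`; the two products are independent and no
  -- induction is needed.
  | _, bracket c, _, bracketCons (h := h₁) c' v =>
    rw [← mulL_single, ← mulL_single, ← bracketConsL_single, mulL_bracketConsL,
      ← bracketL_single, mulL_bracketL_bracketConsL, mulL_bracketL_bracketConsL,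
      map_add, LinearMap.add_apply, mulL_bracketConsL, mulL_bracketConsL]
  | _, bracket c, _, bracket c' =>
    match h'', w'' with
    | false, w'' =>
      rw [← mulL_single, ← mulL_single, ← bracketL_single, ← bracketL_single,
        mulL_bracketL_bracketL, mulL_bracketL_false, mulL_bracketL_bracketConsL, map_add,
        LinearMap.add_apply, mulL_bracketL_false, mulL_bracketL_false]
    | _, bracket c'' =>
      -- Expanding both sides by the Rota-Baxter identity gives brackets of triple products in which
      -- one of the three words has lost its outer bracket. The three corresponding induction
      -- hypotheses, bracketed and added, give the claim. A tail `v` after the last bracket is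
      -- merely carried along.
      have h₁ := mulL_mul_assoc (bracket c) (bracket c') c''
      have h₂ := mulL_mul_assoc (bracket c) c' (bracket c'')
      have h₃ := mulL_mul_assoc c (bracket c') (bracket c'')
      simp only [← mulL_single, ← bracketL_single] at h₁ h₂ h₃ ⊢
      simp only [mulL_bracketL_bracketL, map_add, LinearMap.add_apply] at h₁ h₂ h₃ ⊢
      have h₄ := congrArg (bracketL k _) h₁
      have h₅ := congrArg (bracketL k _) h₂
      have h₆ := congrArg (bracketL k _) h₃
      simp only [map_add] at h₄ h₅ h₆
      convert congrArg₂ (· + ·) (congrArg₂ (· + ·) h₄ h₅) h₆ using 1 <;> abel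
    | _, bracketCons c'' v =>
      have h₁ := mulL_mul_assoc (bracket c) (bracket c') c''
      have h₂ := mulL_mul_assoc (bracket c) c' (bracket c'')
      have h₃ := mulL_mul_assoc c (bracket c') (bracket c'')
      simp only [← mulL_single, ← bracketL_single, ← bracketConsL_single] at h₁ h₂ h₃ ⊢
      simp only [mulL_bracketL_bracketL, mulL_bracketL_bracketConsL, map_add,
        LinearMap.add_apply] at h₁ h₂ h₃ ⊢
      have h₄ := congrArg (fun s => bracketConsL k _ s (Finsupp.single v 1)) h₁
      have h₅ := congrArg (fun s => bracketConsL k _ s (Finsupp.single v 1)) h₂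
      have h₆ := congrArg (fun s => bracketConsL k _ s (Finsupp.single v 1)) h₃
      simp only [map_add, LinearMap.add_apply] at h₄ h₅ h₆
      convert congrArg₂ (· + ·) (congrArg₂ (· + ·) h₄ h₅) h₆ using 1 <;> abel
termination_by sizeOf w + sizeOf w' + sizeOf w''

end Mul

end RBWord

/-! ### The free Rota-Baxter algebra -/

namespace FreeRB

section

variable (k X : Type*) [CommRing k]

/-- The embedding of the span of the words with head `h`. -/
noncomputable def emb (h : Bool) : (RBWord X h →₀ k) →ₗ[k] FreeRB k X :=
  Finsupp.lmapDomain k k fun c => ⟨h, c⟩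

variable {k X}

theorem emb_single {h : Bool} (w : RBWord X h) (c : k) :
    emb k X h (Finsupp.single w c) = Finsupp.single (⟨h, w⟩ : RBWords X) c := by
  simp [emb]

theorem mul_emb {h h' : Bool} (p : RBWord X h →₀ k) (q : RBWord X h' →₀ k) :
    mul k X (emb k X h p) (emb k X h' q) = emb k X h (RBWord.mulL k h h' p q) := by
  have : (mul k X).compl₁₂ (emb k X h) (emb k X h') =
      (RBWord.mulL k h h').compr₂ (emb k X h) := by
    ext w w' : 4
    simp [emb, mul, bilinearExtension, RBWord.mulL]
  exact congrArg (fun m => m p q) this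

theorem op_emb {h : Bool} (p : RBWord X h →₀ k) :
    op k X (emb k X h p) = emb k X true (RBWord.bracketL k h p) := by
  have : op k X ∘ₗ emb k X h = emb k X true ∘ₗ RBWord.bracketL k h := by
    ext w : 2
    simp [emb, op, RBWord.bracketL]
  exact congrArg (fun m => m p) this

theorem mul_single (w w' : RBWords X) :
    mul k X (Finsupp.single w 1) (Finsupp.single w' 1) =
      emb k X w.1 (RBWord.mul k w.2 w'.2) :=
  bilinearExtension_single k _ w w'

theorem op_single (w : RBWords X) (c : k) :
    op k X (Finsupp.single w c) = Finsupp.single ⟨true, .bracket w.2⟩ c := by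
  simp [op]

theorem mul_assoc (x y z : FreeRB k X) :
    mul k X (mul k X x y) z = mul k X x (mul k X y z) := by
  induction x using Finsupp.induction_linear with
  | zero => simp
  | add a b ha hb => simp only [map_add, LinearMap.add_apply, ha, hb]
  | single w c =>
    induction y using Finsupp.induction_linear with
    | zero => simp
    | add a b ha hb => simp only [map_add, LinearMap.add_apply, ha, hb]
    | single w' c' =>
      induction z using Finsupp.induction_linear with
      | zero => simp
      | add a b ha hb => simp only [map_add, ha, hb]
      | single w'' c'' =>
        have hs : ∀ (w : RBWords X) (c : k), Finsupp.single w c =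
            c • emb k X w.1 (Finsupp.single w.2 1) := by simp [emb_single]
        rw [hs w, hs w', hs w'']
        simp only [map_smul, LinearMap.smul_apply, mul_emb, RBWord.mulL_single,
          RBWord.mulL_mul_assoc]

theorem isRotaBaxterAlgebra : IsRotaBaxterAlgebra (0 : k) (mul k X) (op k X) where
  assoc := mul_assoc
  rota_baxter x y := by
    rw [zero_smul, add_zero]
    induction x using Finsupp.induction_linear with
    | zero => simp
    | add a b ha hb => simp only [map_add, LinearMap.add_apply, ha, hb]; abel
    | single w c =>
      induction y using Finsupp.induction_linear with
      | zero => simp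
      | add a b ha hb => simp only [map_add, ha, hb]; abel
      | single w' c' =>
        obtain ⟨h, w⟩ := w
        obtain ⟨h', w'⟩ := w'
        simp only [← emb_single, mul_emb, op_emb, RBWord.mulL_bracketL_bracketL, map_add]

/-- Factors of different kinds just concatenate. With `mul_bracket_letter` this recovers each word
from letters by `⋄` and `R`, as needed for uniqueness of lifts and for identifying `φ`. -/
theorem mul_letter_bracket (x : X) (u : RBWord X true) :
    mul k X (Finsupp.single ⟨false, .letter x⟩ 1) (Finsupp.single ⟨true, u⟩ 1) =
      Finsupp.single ⟨false, .letterCons x u⟩ 1 := by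
  rw [← emb_single, ← emb_single, mul_emb, RBWord.mulL_letter_true, RBWord.consL_single,
    emb_single]

theorem mul_bracket_letter {h : Bool} (w : RBWord X h) (u : RBWord X false) :
    mul k X (Finsupp.single ⟨true, .bracket w⟩ 1) (Finsupp.single ⟨false, u⟩ 1) =
      Finsupp.single ⟨true, .bracketCons w u⟩ 1 := by
  rw [← emb_single, ← emb_single, mul_emb, ← RBWord.bracketL_single, RBWord.mulL_bracketL_false,
    RBWord.bracketConsL_single, emb_single]

end

end FreeRB

/-! ### Evaluation of Rota-Baxter words -/

section Eval

variable {k A X : Type*} [CommRing k] [AddCommGroup A] [Module k A]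
  (mulA : A →ₗ[k] A →ₗ[k] A) (RA : A →ₗ[k] A) (f : X → A)

/-- The value of a Rota-Baxter word in an algebra with a linear operator. -/
def RBWord.eval : {h : Bool} → RBWord X h → A
  | _, letter x => f x
  | _, letterCons x u => mulA (f x) (eval u)
  | _, bracket w => RA (eval w)
  | _, bracketCons w u => mulA (RA (eval w)) (eval u)

/-- Linear extension of `RBWord.eval` to words with a given head. -/
noncomputable def RBWord.evalL (h : Bool) : (RBWord X h →₀ k) →ₗ[k] A :=
  Finsupp.linearCombination k (RBWord.eval mulA RA f)

/-- Linear extension of `RBWord.eval`. -/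
noncomputable def FreeRB.lift : FreeRB k X →ₗ[k] A :=
  Finsupp.linearCombination k fun w => RBWord.eval mulA RA f w.2

namespace RBWord

theorem evalL_letterCons (x : X) (s : RBWord X true →₀ k) :
    evalL mulA RA f false (s.mapDomain fun c => letterCons x c) =
      mulA (f x) (evalL mulA RA f true s) := by
  induction s using Finsupp.induction_linear with
  | zero => simp
  | add a b ha hb => simp [Finsupp.mapDomain_add, ha, hb]
  | single a c => simp [evalL, eval]

theorem evalL_bracket {h : Bool} (s : RBWord X h →₀ k) :
    evalL mulA RA f true (s.mapDomain fun c => bracket c) = RA (evalL mulA RA f h s) := by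
  induction s using Finsupp.induction_linear with
  | zero => simp
  | add a b ha hb => simp [Finsupp.mapDomain_add, ha, hb]
  | single a c => simp [evalL, eval]

theorem evalL_bracketCons_right {h : Bool} (w : RBWord X h) (s : RBWord X false →₀ k) :
    evalL mulA RA f true (s.mapDomain fun c => bracketCons w c) =
      mulA (RA (eval mulA RA f w)) (evalL mulA RA f false s) := by
  induction s using Finsupp.induction_linear with
  | zero => simp
  | add a b ha hb => simp [Finsupp.mapDomain_add, ha, hb]
  | single a c => simp [evalL, eval]

theorem evalL_bracketCons_left {h : Bool} (u : RBWord X false) (s : RBWord X h →₀ k) :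
    evalL mulA RA f true (s.mapDomain fun c => bracketCons c u) =
      mulA (RA (evalL mulA RA f h s)) (eval mulA RA f u) := by
  induction s using Finsupp.induction_linear with
  | zero => simp
  | add a b ha hb => simp [Finsupp.mapDomain_add, ha, hb]
  | single a c => simp [evalL, eval]

theorem evalL_single {h : Bool} (w : RBWord X h) (c : k) :
    evalL mulA RA f h (Finsupp.single w c) = c • eval mulA RA f w := by
  simp [evalL]

variable {mulA RA}

/-- Each clause defining `⋄` becomes an identity in `A`: associativity, vanishing of `f x * f y`, or
the Rota-Baxter identity in weight zero. -/
theorem evalL_mul (hA : IsRotaBaxterAlgebra (0 : k) mulA RA)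
    (hf : ∀ x y, mulA (f x) (f y) = 0) {h h' : Bool} (w : RBWord X h) (w' : RBWord X h') :
    evalL mulA RA f h (mul k w w') = mulA (eval mulA RA f w) (eval mulA RA f w') := by
  have rb : ∀ a b, mulA (RA a) (RA b) = RA (mulA (RA a) b) + RA (mulA a (RA b)) := by
    intro a b
    rw [hA.rota_baxter, zero_smul, add_zero, map_add]
  match h, w, h', w' with
  | _, letterCons x u, _, w' =>
    rw [mul, evalL_letterCons, evalL_mul hA hf u w', eval, hA.assoc]
  | _, bracketCons c u, _, w' =>
    rw [mul, evalL_bracketCons_right, evalL_mul hA hf u w', eval, hA.assoc]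
  | _, letter x, _, letter y => simp [mul, eval, hf]
  | _, letter x, _, letterCons y u => simp [mul, eval, ← hA.assoc, hf]
  | _, letter x, _, bracket c' => simp [mul, eval, evalL_single]
  | _, letter x, _, bracketCons c' v => simp [mul, eval, evalL_single]
  | _, bracket c, _, letter y => simp [mul, eval, evalL_single]
  | _, bracket c, _, letterCons y u => simp [mul, eval, evalL_single]
  | _, bracket c, _, bracket c' =>
    rw [mul, map_add, evalL_bracket, evalL_bracket, evalL_mul hA hf (bracket c) c',
      evalL_mul hA hf c (bracket c')]
    simp only [eval, rb]
  | _, bracket c, _, bracketCons c' v =>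
    rw [mul, map_add, evalL_bracketCons_left, evalL_bracketCons_left, evalL_mul hA hf (bracket c) c',
      evalL_mul hA hf c (bracket c')]
    simp only [eval, ← hA.assoc, rb, map_add, LinearMap.add_apply]
termination_by sizeOf w + sizeOf w'

end RBWord

namespace FreeRB

theorem lift_single (w : RBWords X) :
    lift mulA RA f (Finsupp.single w 1) = RBWord.eval mulA RA f w.2 := by
  simp [lift]

theorem lift_emb {h : Bool} (s : RBWord X h →₀ k) :
    lift mulA RA f (emb k X h s) = RBWord.evalL mulA RA f h s := by
  simp [lift, emb, RBWord.evalL, Finsupp.linearCombination_mapDomain, Function.comp_def]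

theorem lift_op (x : FreeRB k X) : lift mulA RA f (op k X x) = RA (lift mulA RA f x) := by
  induction x using Finsupp.induction_linear with
  | zero => simp
  | add a b ha hb => simp [ha, hb]
  | single w c => simp [op_single, lift, RBWord.eval]

variable {mulA RA f}

theorem lift_isAlgebraHom (hA : IsRotaBaxterAlgebra (0 : k) mulA RA)
    (hf : ∀ x y, mulA (f x) (f y) = 0) :
    IsAlgebraHom (mul k X) mulA (lift mulA RA f) := by
  refine map_bilinearExtension _ _ _ fun w w' => ?_
  rw [lift_single, lift_single, ← RBWord.evalL_mul f hA hf, ← lift_emb]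
  rfl

theorem hom_eq_lift {g : FreeRB k X →ₗ[k] A} (hg : IsAlgebraHom (mul k X) mulA g)
    (hop : ∀ x, g (op k X x) = RA (g x))
    (hf : ∀ x, g (Finsupp.single ⟨false, .letter x⟩ 1) = f x) : g = lift mulA RA f := by
  have main : ∀ {h : Bool} (w : RBWord X h),
      g (Finsupp.single ⟨h, w⟩ 1) = RBWord.eval mulA RA f w := by
    intro h w
    induction w with
    | letter x => exact hf x
    | letterCons x u ih => rw [← mul_letter_bracket, hg, hf, ih, RBWord.eval]
    | bracket w ih => rw [← op_single ⟨_, w⟩, hop, ih, RBWord.eval]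
    | bracketCons w u ihw ihu =>
      rw [← mul_bracket_letter, hg, ihu, ← op_single ⟨_, w⟩, hop, ihw, RBWord.eval]
  refine Finsupp.lhom_ext' fun w => LinearMap.ext_ring ?_
  simpa [lift_single] using main w.2

end FreeRB

end Eval

theorem FreeRB.isFreeRotaBaxterAlgebra {k : Type u} {V : Type v} {X : Type t} [CommRing k]
    [AddCommGroup V] [Module k V] (b : Module.Basis X k V) :
    IsFreeRotaBaxterAlgebra.{w₂} (0 : k) (0 : V →ₗ[k] V →ₗ[k] V)
      (FreeRB.mul k X) (FreeRB.op k X) (FreeRB.incl b) where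
  isRotaBaxterAlgebra := isRotaBaxterAlgebra
  isAlgebraHom := by
    have : (mul k X).compl₁₂ (incl b) (incl b) = 0 := by
      refine b.ext fun x => b.ext fun y => ?_
      simp [incl, mul_single, RBWord.mul]
    intro x y
    simpa using (congrArg (fun m => m x y) this).symm
  existsUnique_lift A _ _ mulA RA hA f hf := by
    refine ⟨lift mulA RA fun x => f (b x), ⟨⟨lift_isAlgebraHom hA fun x y => ?_, lift_op _ _ _⟩,
      ?_⟩, ?_⟩
    -- Multiplicativity of `f` for the zero product on `V` makes the product of two values equal to
    -- `f 0`.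
    · rw [← hf]
      simp
    · refine b.ext fun x => ?_
      simp [incl, lift_single, RBWord.eval]
    · rintro g ⟨⟨hg, hop⟩, rfl⟩
      refine hom_eq_lift hg hop fun x => ?_
      simp [incl]

/-! ### The map from trees to Rota-Baxter words -/

section TreeWord

variable {k X : Type*} [CommRing k]

/-- Evaluating `T` in `RB(V)` multiplies `⌊φ(T^ℓ)⌋`, `x` and `⌊φ(T^r)⌋`, whose neighbours are of
different kinds, so the result is a single word. -/
theorem single_treeWord (T : BinaryTree X) (hT : T ≠ .nil) :
    Finsupp.single (treeWord T hT) (1 : k) =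
      treeEval (FreeRB.prec k X) (FreeRB.succ k X)
        (fun x => Finsupp.single ⟨false, .letter x⟩ 1) T := by
  have hp : ∀ (u : RBWords X) (w : RBWords X),
      FreeRB.prec k X (Finsupp.single u 1) (Finsupp.single w 1) =
        FreeRB.mul k X (Finsupp.single u 1) (Finsupp.single ⟨true, .bracket w.2⟩ 1) := by
    intro u w
    rw [← FreeRB.op_single]
    rfl
  have hs : ∀ (u : RBWords X) (w : RBWords X),
      FreeRB.succ k X (Finsupp.single u 1) (Finsupp.single w 1) =
        FreeRB.mul k X (Finsupp.single ⟨true, .bracket u.2⟩ 1) (Finsupp.single w 1) := by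
    intro u w
    rw [← FreeRB.op_single]
    rfl
  induction T with
  | nil => exact absurd rfl hT
  | node x l r ihl ihr =>
    cases l with
    | nil =>
      cases r with
      | nil => rw [treeWord, treeEval]
      | node => rw [treeWord, treeEval, ← ihr (by simp), hp, FreeRB.mul_letter_bracket]
    | node =>
      cases r with
      | nil => rw [treeWord, treeEval, ← ihl (by simp), hs, FreeRB.mul_bracket_letter]
      | node =>
        rw [treeWord, treeEval, ← ihl (by simp), ← ihr (by simp), hs, FreeRB.mul_bracket_letter,
          hp, ← FreeRB.mul_bracket_letter, ← FreeRB.mul_bracket_letter _ (.letter x),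
          FreeRB.mul_assoc, FreeRB.mul_letter_bracket]

theorem dendToRB_single (T : NTree X) (c : k) :
    dendToRB k X (Finsupp.single T c) = Finsupp.single (treeWord T.1 T.2) c := by
  simp [dendToRB]

theorem dendToRB_eq_lift :
    dendToRB k X = Dend.lift (FreeRB.prec k X) (FreeRB.succ k X)
      (fun x => Finsupp.single ⟨false, .letter x⟩ 1) := by
  refine Finsupp.lhom_ext' fun T => LinearMap.ext_ring ?_
  simpa [Dend.lift_single, dendToRB_single] using single_treeWord T.1 T.2

theorem FreeRB.isDendriform : IsDendriform (FreeRB.prec k X) (FreeRB.succ k X) :=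
  FreeRB.isRotaBaxterAlgebra.isDendriform

theorem dendToRB_isDendriformHom :
    IsDendriformHom (Dend.prec k X) (Dend.succ k X) (FreeRB.prec k X) (FreeRB.succ k X)
      (dendToRB k X) := by
  rw [dendToRB_eq_lift]
  exact Dend.lift_isDendriformHom _ FreeRB.isDendriform

theorem dendToRB_comp_incl {V : Type*} [AddCommGroup V] [Module k V] (b : Module.Basis X k V) :
    dendToRB k X ∘ₗ Dend.incl b = FreeRB.incl b := by
  refine b.ext fun x => ?_
  simp [Dend.incl, FreeRB.incl, dendToRB_single, NTree.graft, treeWord]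

/-- The tree of a Rota-Baxter word; it inverts `treeWord`. -/
def RBWord.toTree : {h : Bool} → RBWord X h → BinaryTree X
  | _, letter x => .node x .nil .nil
  | _, letterCons x u => .node x .nil (toTree u)
  | _, bracket w => toTree w
  | _, bracketCons w u =>
    match toTree u with
    -- A default that is never reached: a word beginning with a letter has a tree with a root, and
    -- its left subtree is `|`, to be replaced by that of `w`.
    | .nil => .nil
    | .node x _ r => .node x (toTree w) r

theorem toTree_treeWord (T : BinaryTree X) (hT : T ≠ .nil) : (treeWord T hT).2.toTree = T := by
  induction T with
  | nil => exact absurd rfl hT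
  | node x l r ihl ihr =>
    cases l <;> cases r <;> simp_all [treeWord, RBWord.toTree]

theorem treeWord_injective :
    Function.Injective fun T : NTree X => treeWord T.1 T.2 := by
  intro T U h
  apply Subtype.ext
  rw [← toTree_treeWord T.1 T.2, ← toTree_treeWord U.1 U.2]
  exact congrArg (fun w : RBWords X => w.2.toTree) h

theorem dendToRB_injective : Function.Injective (dendToRB k X) :=
  Finsupp.mapDomain_injective treeWord_injective

end TreeWord

/-- Dendriform dialgebra structures pull back along injective homomorphisms. -/
theorem IsDendriformHom.isDendriform_of_injective {k D E : Type*} [CommRing k] [AddCommGroup D]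
    [Module k D] [AddCommGroup E] [Module k E] {precD succD : D →ₗ[k] D →ₗ[k] D}
    {precE succE : E →ₗ[k] E →ₗ[k] E} {f : D →ₗ[k] E}
    (hf : IsDendriformHom precD succD precE succE f) (hinj : Function.Injective f)
    (hE : IsDendriform precE succE) : IsDendriform precD succD where
  prec_prec x y z := hinj <| by simp only [hf.map_prec, hf.map_succ, map_add f, hE.prec_prec]
  succ_prec x y z := hinj <| by simp only [hf.map_prec, hf.map_succ, hE.succ_prec]
  succ_succ x y z := hinj <| by simp only [hf.map_prec, hf.map_succ, map_add f, hE.succ_succ]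

/-- Injectivity of `φ` transports the axioms from `RB(V)`, which spares an induction over triples of
trees. -/
theorem Dend.isFreeDendriform {k : Type u} {V : Type v} {X : Type t} [CommRing k]
    [AddCommGroup V] [Module k V] (b : Module.Basis X k V) :
    IsFreeDendriform.{w₁} (Dend.prec k X) (Dend.succ k X) (Dend.incl b) where
  isDendriform :=
    dendToRB_isDendriformHom.isDendriform_of_injective dendToRB_injective FreeRB.isDendriform
  existsUnique_lift _ _ _ _ _ hD f := Dend.existsUnique_lift b hD f

/-! ### Dendriform diwords -/

section Diword

variable {X : Type*}

/-- The state of a scanner inside one pair of brackets: what has been read so far at this level. -/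
inductive ScanState : Type
  /-- nothing has been read -/
  | start
  /-- a single bracketed word has been read -/
  | bracketed
  /-- a letter, possibly preceded by a bracketed word, has been read -/
  | lettered
  /-- a letter and a bracketed word after it have been read -/
  | full

/-- One step of the scanner, on a stack with one state for every open bracket. It rejects a second
letter at the same level and a bracketed word that is bracketed again. -/
def scanStep : List ScanState → BracketLetter X → Option (List ScanState)
  | .start :: S, .var _ => some (.lettered :: S)
  | .bracketed :: S, .var _ => some (.lettered :: S)
  | .start :: S, .lb => some (.start :: .start :: S)
  | .lettered :: S, .lb => some (.start :: .lettered :: S)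
  | .lettered :: .start :: S, .rb => some (.bracketed :: S)
  | .full :: .start :: S, .rb => some (.bracketed :: S)
  | .lettered :: .lettered :: S, .rb => some (.full :: S)
  | .full :: .lettered :: S, .rb => some (.full :: S)
  | _, _ => none

/-- The hypothesis `hl` is the induction hypothesis of `scan_spell`: the content leaves outer levels
alone, so the closing bracket meets the level that was open before. -/
theorem scan_bracket {l : List (BracketLetter X)}
    (hl : ∀ s S S', l.foldlM scanStep (s :: S) = some S' → ∃ s', S' = s' :: S)
    {s : ScanState} {S S' : List ScanState}
    (h : (BracketLetter.lb :: (l ++ [.rb])).foldlM scanStep (s :: S) = some S') :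
    (s = .start ∧ S' = .bracketed :: S) ∨ (s = .lettered ∧ S' = .full :: S) := by
  rw [List.foldlM_cons] at h
  cases s <;> simp [scanStep] at h
  all_goals
    obtain ⟨S₁, h₁, h₂⟩ := Option.bind_eq_some_iff.1 h
    obtain ⟨s', rfl⟩ := hl _ _ _ h₁
    cases s' <;> simp_all

/-- Scanning a Rota-Baxter word changes at most the state of the current level. -/
theorem scan_spell {h : Bool} (w : RBWord X h) (s : ScanState) (S S' : List ScanState)
    (hw : w.spell.foldlM scanStep (s :: S) = some S') : ∃ s', S' = s' :: S := by
  induction w generalizing s S S' with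
  | letter x => cases s <;> simp [RBWord.spell, scanStep] at hw <;> exact ⟨_, hw.symm⟩
  | letterCons x u ih =>
    cases s <;> simp [RBWord.spell, scanStep] at hw <;> exact ih _ _ _ hw
  | bracket w ih =>
    rcases scan_bracket ih hw with ⟨_, rfl⟩ | ⟨_, rfl⟩ <;> exact ⟨_, rfl⟩
  | bracketCons w u ihw ihu =>
    rw [RBWord.spell, show BracketLetter.lb :: (w.spell ++ .rb :: u.spell) =
      (.lb :: (w.spell ++ [.rb])) ++ u.spell by simp, List.foldlM_append] at hw
    obtain ⟨S₁, h₁, h₂⟩ := Option.bind_eq_some_iff.1 hw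
    rcases scan_bracket ihw h₁ with ⟨_, rfl⟩ | ⟨_, rfl⟩ <;> exact ihu _ _ _ h₂

/-- The outer bracket opens a level in state `start`, which the inner bracketed word moves to
`bracketed`; from there closing is rejected. -/
theorem scan_bracket_bracket {h : Bool} (w : RBWord X h) (S : List ScanState) :
    ([BracketLetter.lb, .lb] ++ w.spell ++ [BracketLetter.rb, .rb]).foldlM scanStep S = none := by
  have e : [BracketLetter.lb, .lb] ++ w.spell ++ [BracketLetter.rb, .rb] =
      .lb :: ((.lb :: (w.spell ++ [.rb])) ++ [.rb]) := by simp
  rw [e, List.foldlM_cons, Option.eq_none_iff_forall_ne_some]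
  intro S' h
  obtain ⟨S₁, h₁, h₂⟩ := Option.bind_eq_some_iff.1 h
  rw [List.foldlM_append] at h₂
  obtain ⟨S₂, h₃, h₄⟩ := Option.bind_eq_some_iff.1 h₂
  cases S₁ with
  | nil => simp [scanStep] at h₃
  | cons s S₁ =>
    rcases scan_bracket (scan_spell w) h₃ with ⟨_, rfl⟩ | ⟨rfl, rfl⟩
    · simp [scanStep] at h₄
    · rcases S with _ | ⟨_ | _ | _ | _, S⟩ <;> simp [scanStep] at h₁

/-- The letter `x` leaves the state `lettered`, the bracketed word moves it to `full`, and `full`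
admits no letter. -/
theorem scan_letter_bracket_letter {h : Bool} (x y : X) (w : RBWord X h) (S : List ScanState) :
    ([BracketLetter.var x, .lb] ++ w.spell ++ [BracketLetter.rb, .var y]).foldlM scanStep S = none := by
  have e : [BracketLetter.var x, .lb] ++ w.spell ++ [BracketLetter.rb, .var y] =
      .var x :: ((.lb :: (w.spell ++ [.rb])) ++ [.var y]) := by simp
  rw [e, List.foldlM_cons, Option.eq_none_iff_forall_ne_some]
  intro S' h
  obtain ⟨S₁, h₁, h₂⟩ := Option.bind_eq_some_iff.1 h
  rw [List.foldlM_append] at h₂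
  obtain ⟨S₂, h₃, h₄⟩ := Option.bind_eq_some_iff.1 h₂
  cases S₁ with
  | nil => simp [scanStep] at h₃
  | cons s S₁ =>
    rcases scan_bracket (scan_spell w) h₃ with ⟨rfl, rfl⟩ | ⟨_, rfl⟩
    · rcases S with _ | ⟨_ | _ | _ | _, S⟩ <;> simp [scanStep] at h₁
    · simp [scanStep] at h₄

/-- Rejection from every stack is required because the prefix before `p` may leave any stack behind.
-/
theorem not_infix_of_scan {p l : List (BracketLetter X)} {S S' : List ScanState}
    (hp : ∀ S, p.foldlM scanStep S = none) (hl : l.foldlM scanStep S = some S') : ¬ p <:+: l := by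
  rintro ⟨a, c, rfl⟩
  rw [List.foldlM_append, List.foldlM_append] at hl
  cases h : a.foldlM scanStep S <;> simp [h, hp] at hl

/-- The word of a tree is accepted by the scanner, at any place where a letter may follow. -/
theorem scan_treeWord (T : BinaryTree X) (hT : T ≠ .nil) (S : List ScanState) :
    (treeWord T hT).2.spell.foldlM scanStep (.start :: S) = some (.lettered :: S) ∨
    (treeWord T hT).2.spell.foldlM scanStep (.start :: S) = some (.full :: S) := by
  induction T generalizing S with
  | nil => exact absurd rfl hT
  | node x l r ihl ihr =>
    cases l with
    | nil =>
      cases r with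
      | nil => simp [treeWord, RBWord.spell, scanStep]
      | node z r₁ r₂ =>
        rcases ihr (by simp) (.lettered :: S) with h | h <;>
        simp [treeWord, RBWord.spell, scanStep, h]
    | node y l₁ l₂ =>
      cases r with
      | nil =>
        rcases ihl (by simp) (.start :: S) with h | h <;>
        simp [treeWord, RBWord.spell, scanStep, h]
      | node z r₁ r₂ =>
        rcases ihr (by simp) (.lettered :: S) with h | h <;>
        rcases ihl (by simp) (.start :: S) with h' | h' <;>
        simp [treeWord, RBWord.spell, scanStep, h, h']

theorem isDiword_treeWord (T : BinaryTree X) (hT : T ≠ .nil) : IsDiword (treeWord T hT) where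
  not_bracket w h := by
    cases T with
    | nil => exact absurd rfl hT
    | node x l r => cases l <;> cases r <;> simp [treeWord] at h
  not_bracket_bracket w := by
    rcases scan_treeWord T hT [] with h | h <;>
    exact not_infix_of_scan (scan_bracket_bracket w.2) h
  not_letter_bracket_letter x y w := by
    rcases scan_treeWord T hT [] with h | h <;>
    exact not_infix_of_scan (scan_letter_bracket_letter x y w.2) h

/-- A factor of a diword that is not a bracketed word is a diword. -/
theorem IsDiword.of_infix {u v : RBWords X} (hu : IsDiword u) (hvu : v.2.spell <:+: u.2.spell)
    (hv : ∀ w : RBWords X, v ≠ ⟨true, .bracket w.2⟩) : IsDiword v where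
  not_bracket := hv
  not_bracket_bracket w h := hu.not_bracket_bracket w (h.trans hvu)
  not_letter_bracket_letter x y w h := hu.not_letter_bracket_letter x y w (h.trans hvu)

/-- The content of a bracket in a diword is a diword. -/
theorem IsDiword.content {u : RBWords X} (hu : IsDiword u) {h : Bool} (w : RBWord X h)
    (hw : .lb :: (w.spell ++ [.rb]) <:+: u.2.spell) : IsDiword (⟨h, w⟩ : RBWords X) := by
  refine hu.of_infix (List.IsInfix.trans ⟨[.lb], [.rb], by simp⟩ hw) ?_
  -- A content of the form `⌊c⌋` would produce the forbidden subword `⌊⌊c⌋⌋`.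
  rintro ⟨h', c⟩ hc
  cases hc
  exact hu.not_bracket_bracket ⟨h', c⟩ (by simpa [RBWord.spell] using hw)

theorem treeWord_node_nil_nil (x : X) (h : BinaryTree.node x .nil .nil ≠ .nil) :
    treeWord (.node x .nil .nil) h = ⟨false, .letter x⟩ := by
  rw [treeWord]

theorem treeWord_node_nil (x : X) (r : NTree X) (h : BinaryTree.node x .nil r.1 ≠ .nil) :
    treeWord (.node x .nil r.1) h =
      ⟨false, .letterCons x (.bracket (treeWord r.1 r.2).2)⟩ := by
  obtain ⟨r, hr⟩ := r
  cases r with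
  | nil => exact absurd rfl hr
  | node => rw [treeWord]

theorem treeWord_node_left (x : X) (l : NTree X) (h : BinaryTree.node x l.1 .nil ≠ .nil) :
    treeWord (.node x l.1 .nil) h =
      ⟨true, .bracketCons (treeWord l.1 l.2).2 (.letter x)⟩ := by
  obtain ⟨l, hl⟩ := l
  cases l with
  | nil => exact absurd rfl hl
  | node => rw [treeWord]

theorem treeWord_node (x : X) (l r : NTree X) (h : BinaryTree.node x l.1 r.1 ≠ .nil) :
    treeWord (.node x l.1 r.1) h =
      ⟨true, .bracketCons (treeWord l.1 l.2).2
        (.letterCons x (.bracket (treeWord r.1 r.2).2))⟩ := by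
  obtain ⟨l, hl⟩ := l
  obtain ⟨r, hr⟩ := r
  cases l with
  | nil => exact absurd rfl hl
  | node =>
    cases r with
    | nil => exact absurd rfl hr
    | node => rw [treeWord]

/-- Every diword is the word of a tree. -/
theorem IsDiword.exists_treeWord {h : Bool} (u : RBWord X h)
    (hu : IsDiword (⟨h, u⟩ : RBWords X)) :
    ∃ T : NTree X, treeWord T.1 T.2 = ⟨h, u⟩ := by
  match h, u with
  | _, .letter x => exact ⟨NTree.graft x .nil .nil, treeWord_node_nil_nil x _⟩
  | _, .letterCons x (.bracket w) =>
    obtain ⟨r, hr⟩ := IsDiword.exists_treeWord w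
      (hu.content w ⟨[.var x], [], by simp [RBWord.spell]⟩)
    exact ⟨NTree.graft x .nil r.1, (treeWord_node_nil x r _).trans (by rw [hr])⟩
  -- A second letter at top level must follow `x ⌊w⌋`, which is the forbidden pattern; the later
  -- cases with `y` are alike.
  | _, .letterCons x (.bracketCons w (.letter y)) =>
    exact absurd ⟨[], [], by simp [RBWord.spell]⟩ (hu.not_letter_bracket_letter x y ⟨_, w⟩)
  | _, .letterCons x (.bracketCons w (.letterCons y v)) =>
    exact absurd ⟨[], v.spell, by simp [RBWord.spell]⟩
      (hu.not_letter_bracket_letter x y ⟨_, w⟩)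
  | _, .bracket w => exact absurd rfl (hu.not_bracket ⟨_, w⟩)
  | _, .bracketCons w (.letter x) =>
    obtain ⟨l, hl⟩ := IsDiword.exists_treeWord w
      (hu.content w ⟨[], [.var x], by simp [RBWord.spell]⟩)
    exact ⟨NTree.graft x l.1 .nil, (treeWord_node_left x l _).trans (by rw [hl])⟩
  | _, .bracketCons w (.letterCons x (.bracket w')) =>
    obtain ⟨l, hl⟩ := IsDiword.exists_treeWord w
      (hu.content w ⟨[], .var x :: (RBWord.bracket w').spell, by simp [RBWord.spell]⟩)
    obtain ⟨r, hr⟩ := IsDiword.exists_treeWord w'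
      (hu.content w' ⟨(RBWord.bracket w).spell ++ [.var x], [], by simp [RBWord.spell]⟩)
    exact ⟨NTree.graft x l.1 r.1, (treeWord_node x l r _).trans (by rw [hl, hr])⟩
  | _, .bracketCons w (.letterCons x (.bracketCons w' (.letter y))) =>
    exact absurd ⟨(RBWord.bracket w).spell, [], by simp [RBWord.spell]⟩
      (hu.not_letter_bracket_letter x y ⟨_, w'⟩)
  | _, .bracketCons w (.letterCons x (.bracketCons w' (.letterCons y v))) =>
    exact absurd ⟨(RBWord.bracket w).spell, v.spell, by simp [RBWord.spell]⟩
      (hu.not_letter_bracket_letter x y ⟨_, w'⟩)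
termination_by sizeOf u

theorem range_treeWord :
    Set.range (fun T : NTree X => treeWord T.1 T.2) = {u : RBWords X | IsDiword u} := by
  ext u
  constructor
  · rintro ⟨T, rfl⟩
    exact isDiword_treeWord T.1 T.2
  · exact fun hu => IsDiword.exists_treeWord u.2 hu

/-- As `φ` sends basis trees to basis words, its image is the span of these words, which
`range_treeWord` identifies with the diwords. -/
theorem range_dendToRB (k : Type*) [CommRing k] :
    LinearMap.range (dendToRB k X) = diwordSpan k X := by
  have : dendToRB k X =
      Finsupp.linearCombination k fun T : NTree X => Finsupp.single (treeWord T.1 T.2) 1 :=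
    Finsupp.lhom_ext' fun T => LinearMap.ext_ring (by simp [dendToRB_single])
  rw [this, Finsupp.range_linearCombination, diwordSpan, ← range_treeWord, ← Set.range_comp]
  rfl

end Diword

theorem mainTheorem4 {k : Type u} {V : Type v} {X : Type t} [Field k]
    [AddCommGroup V] [Module k V] (b : Module.Basis X k V) :
    -- the two algebras are the free ones
    IsFreeDendriform.{w₁} (Dend.prec k X) (Dend.succ k X) (Dend.incl b) ∧
    IsFreeRotaBaxterAlgebra.{w₂} (0 : k) (0 : V →ₗ[k] V →ₗ[k] V)
      (FreeRB.mul k X) (FreeRB.op k X) (FreeRB.incl b) ∧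
    -- the free Rota-Baxter algebra is a dendriform dialgebra, and `φ` is a morphism to it
    IsDendriform (FreeRB.prec k X) (FreeRB.succ k X) ∧
    IsDendriformHom (Dend.prec k X) (Dend.succ k X) (FreeRB.prec k X) (FreeRB.succ k X)
      (dendToRB k X) ∧
    -- `φ` is the unique morphism of dendriform dialgebras that extends `j_V`
    dendToRB k X ∘ₗ Dend.incl b = FreeRB.incl b ∧
    (∀ g : Dend k X →ₗ[k] FreeRB k X,
      IsDendriformHom (Dend.prec k X) (Dend.succ k X) (FreeRB.prec k X) (FreeRB.succ k X) g →
      g ∘ₗ Dend.incl b = FreeRB.incl b → g = dendToRB k X) ∧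
    -- image and injectivity
    LinearMap.range (dendToRB k X) = diwordSpan k X ∧
    Function.Injective (dendToRB k X) :=
  ⟨Dend.isFreeDendriform b, FreeRB.isFreeRotaBaxterAlgebra b, FreeRB.isDendriform,
    dendToRB_isDendriformHom, dendToRB_comp_incl b,
    fun _ hg hj => (Dend.existsUnique_lift b FreeRB.isDendriform (FreeRB.incl b)).unique
      ⟨hg, hj⟩ ⟨dendToRB_isDendriformHom, dendToRB_comp_incl b⟩,
    range_dendToRB k, dendToRB_injective⟩
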